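/- Consider $n$ asynchronous deterministic processes $p_1,\dots,p_n$ on a fully connected point-to-point network. At most $t$ processes are Byzantine (they collude and behave arbitrarily); the others are correct, never stop, and $c$ denotes their number in a given execution. Correct processes send implementation messages only by broadcasting them, i.e. by sending one copy to each of the $n$ processes. Between correct processes the network neither creates, corrupts nor duplicates messages; of each message broadcast by a correct process, a message adversary may suppress up to $d$ of the copies intended for correct processes, and every other copy for a correct process is received after an arbitrary finite delay. The system is either signature-free or equipped with unforgeable signatures: then a sent message can contain only signatures made with the sender's own key (for Byzantine processes, with a key of some Byzantine process) or already present in messages known to the sender. An algorithm implements the MBRB abstraction if, in every execution in which no correct process MBRB-broadcasts twice with the same sequence number, the following hold. - Validity: if a correct $p_i$ delivers $(m,sn)$ from a correct $p_j$, then $p_j$ MBRB-broadcast $(m,sn)$. - No-duplication: a correct process delivers at most once from a process $p_j$ with sequence number $sn$. - No-duplicity: no two different correct processes deliver different messages from the same $p_j$ with the same $sn$. - Local-delivery: if a correct $p_i$ MBRB-broadcasts $(m,sn)$, then some correct process delivers $(m,sn)$ from $p_i$. - Global-delivery: if a correct process delivers $(m,sn)$ from $p_j$, then at least $\ell=c-d$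 correct processes deliver $(m,sn)$ from $p_j$. The algorithm is event-driven if, at correct processes, only an invocation of the MBRB-broadcast operation or the reception of an implementation message can generate the sending of implementation messages. Theorem. Let $n\ge 3$, $t\ge 1$, $d\ge 0$ be integers with $d<n-t$, and suppose that there are at least two different application messages. If $n\le 3t+2d$, then no event-driven algorithm, signature-free or signature-based, implements the MBRB abstraction in the $n$-process asynchronous system with up to $t$ Byzantine processes and a message adversary that may suppress up to $d$ copies of each message broadcast by a correct process. -/

import Mathlib

namespace MBRB

/-- Contents of implementation messages: arbitrary data from `D`, closed under pairing and under
signing by one of the `n` processes (`signed i a` is `a` together with the signature of process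
`i` on `a`; a process has exactly one signature on a given content). -/
inductive Msg (n : ℕ) (D : Type*) where
  | data (x : D) : Msg n D
  | pair (a b : Msg n D) : Msg n D
  | signed (i : Fin n) (a : Msg n D) : Msg n D

/-- The signatures occurring in a message, as pairs (signer, signed content). -/
def Msg.sigs {n : ℕ} {D : Type*} : Msg n D → Set (Fin n × Msg n D)
  | .data _ => ∅
  | .pair a b => a.sigs ∪ b.sigs
  | .signed i a => insert (i, a) a.sigs

/-- Whether the system offers unforgeable digital signatures. -/
inductive SigMode where
  | signatureFree
  | signatureBased

/-- What can be sent by a coalition that owns the private keys of the processes in `keys` and has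
seen the messages in `known`. With signatures, every signature in the message must be made with
one of these keys or be copied from a seen message. Without signatures there is no restriction
(then `signed i a` is plain forgeable data). -/
def CanSend {n : ℕ} {D : Type*} (mode : SigMode) (keys : Set (Fin n)) (known : Set (Msg n D))
    (μ : Msg n D) : Prop :=
  match mode with
  | .signatureFree => True
  | .signatureBased => ∀ i a, (i, a) ∈ μ.sigs → i ∈ keys ∨ ∃ μ' ∈ known, (i, a) ∈ μ'.sigs

/-- Local events of a process. -/
inductive Input (n : ℕ) (D V : Type*) where
  /-- the application invokes the broadcast of app-message `v` with sequence number `sn` -/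
  | invoke (v : V) (sn : ℕ) : Input n D V
  /-- an implementation message is received on the channel from process `j` -/
  | recv (j : Fin n) (μ : Msg n D) : Input n D V
  /-- a spontaneous local step, caused neither by the application nor by a reception -/
  | tick : Input n D V

/-- Effects of one local step: the implementation messages that are broadcast (each of them sent
to all `n` processes, the sender included), and the deliveries `(v, sn, j)` to the application,
meaning "app-message `v` with sequence number `sn` from process `j`". -/
structure Output (n : ℕ) (D V : Type*) where
  sends : List (Msg n D)
  delivers : List (V × ℕ × Fin n)

/-- A deterministic distributed algorithm: the reaction of process `i` to an event, as a function
of the past local events of `i` (hence of its local state). -/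
structure Algorithm (n : ℕ) (D V : Type*) where
  react : Fin n → List (Input n D V) → Input n D V → Output n D V

/-- The messages received in a local history. -/
def received {n : ℕ} {D V : Type*} (h : List (Input n D V)) : Set (Msg n D) :=
  {μ | ∃ j, Input.recv j μ ∈ h}

/-- The algorithm does not forge signatures: process `i` only uses its own private key and
signatures that it has received. -/
def Algorithm.RespectsSignatures {n : ℕ} {D V : Type*} (A : Algorithm n D V) (mode : SigMode) :
    Prop :=
  ∀ i h x, ∀ μ ∈ (A.react i h x).sends, CanSend mode {i} (received (h ++ [x])) μ

/-- Event-driven: only invocations and receptions generate the sending of implementation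
messages. -/
def Algorithm.EventDriven {n : ℕ} {D V : Type*} (A : Algorithm n D V) : Prop :=
  ∀ i h, (A.react i h Input.tick).sends = []

/-- The raw data of an infinite run. At time `k` either nothing happens at correct processes, or
one correct process handles one local event. If that event is a reception from a correct process,
`src k = (k₀, l)` says that what is received is a copy of the `l`-th message broadcast by the
step at time `k₀`. -/
structure Run (n : ℕ) (D V : Type*) where
  byz : Finset (Fin n)
  event : ℕ → Option (Fin n × Input n D V)
  src : ℕ → ℕ × ℕ

namespace Run

/-- The number of correct processes. -/
def numCorrect {n : ℕ} {D V : Type*} (r : Run n D V) : ℕ := n - r.byz.card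

/-- The local events of process `i` strictly before time `k`. -/
def history {n : ℕ} {D V : Type*} (r : Run n D V) (i : Fin n) (k : ℕ) : List (Input n D V) :=
  (List.range k).filterMap fun k' =>
    match r.event k' with
    | none => none
    | some (i', x) => if i' = i then some x else none

/-- The effects of the step taken at time `k`. -/
def output {n : ℕ} {D V : Type*} (r : Run n D V) (A : Algorithm n D V) (k : ℕ) : Output n D V :=
  match r.event k with
  | none => ⟨[], []⟩
  | some (i, x) => A.react i (r.history i k) x

/-- The `p.2`-th message broadcast by the step at time `p.1` is `μ`, and that step is taken by
process `i`. -/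
def Broadcasts {n : ℕ} {D V : Type*} (r : Run n D V) (A : Algorithm n D V) (i : Fin n)
    (p : ℕ × ℕ) (μ : Msg n D) : Prop :=
  (∃ x, r.event p.1 = some (i, x)) ∧ (r.output A p.1).sends[p.2]? = some μ

/-- The (correct) process `i` invokes the broadcast of `v` with sequence number `sn`. -/
def Invokes {n : ℕ} {D V : Type*} (r : Run n D V) (i : Fin n) (v : V) (sn : ℕ) : Prop :=
  ∃ k, r.event k = some (i, Input.invoke v sn)

/-- The `p.2`-th delivery in the step at time `p.1`, taken by process `i`, is that of app-message
`v` with sequence number `sn` from process `j`. -/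
def DeliversAt {n : ℕ} {D V : Type*} (r : Run n D V) (A : Algorithm n D V) (i : Fin n)
    (p : ℕ × ℕ) (v : V) (sn : ℕ) (j : Fin n) : Prop :=
  (∃ x, r.event p.1 = some (i, x)) ∧ (r.output A p.1).delivers[p.2]? = some (v, sn, j)

/-- At some time, process `i` delivers `v` with sequence number `sn` from process `j`. -/
def Delivers {n : ℕ} {D V : Type*} (r : Run n D V) (A : Algorithm n D V) (i : Fin n)
    (v : V) (sn : ℕ) (j : Fin n) : Prop :=
  ∃ p, r.DeliversAt A i p v sn j

/-- `r` is a run of `A` in the asynchronous system with at most `t` Byzantine processes and a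
message adversary of power `d`. Message delays and relative speeds are arbitrary but finite.
A message of a Byzantine process appears in the run when a correct process receives it; it may
be anything that the Byzantine processes, with their pooled keys and everything that correct
processes have broadcast so far, are able to produce. -/
structure IsRunOf {n : ℕ} {D V : Type*} (r : Run n D V) (A : Algorithm n D V) (mode : SigMode)
    (t d : ℕ) : Prop where
  byz_card : r.byz.card ≤ t
  /-- the recorded steps are those of correct processes -/
  correct_steps : ∀ k i x, r.event k = some (i, x) → i ∉ r.byz
  /-- a correct process does not use a sequence number twice -/
  seq_once : ∀ k k' i v v' sn, r.event k = some (i, Input.invoke v sn) →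
    r.event k' = some (i, Input.invoke v' sn) → k = k'
  /-- a correct process never stops -/
  never_stops : ∀ i, i ∉ r.byz → ∀ k, ∃ k', k ≤ k' ∧ r.event k' = some (i, Input.tick)
  /-- between correct processes the network neither creates nor corrupts messages -/
  recv_sent : ∀ k i j μ, r.event k = some (j, Input.recv i μ) → i ∉ r.byz →
    (r.src k).1 < k ∧ r.Broadcasts A i (r.src k) μ
  /-- between correct processes the network does not duplicate messages -/
  recv_once : ∀ k k' i i' j μ μ', r.event k = some (j, Input.recv i μ) →
    r.event k' = some (j, Input.recv i' μ') → i ∉ r.byz → i' ∉ r.byz →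
    r.src k = r.src k' → k = k'
  /-- Byzantine processes send what they like, up to unforgeability of signatures -/
  recv_byz : ∀ k i j μ, r.event k = some (j, Input.recv i μ) → i ∈ r.byz →
    CanSend mode (r.byz : Set (Fin n)) {μ' | ∃ k', k' < k ∧ μ' ∈ (r.output A k').sends} μ
  /-- of each message broadcast by a correct process, at most `d` of the copies for correct
  processes are suppressed, all others are eventually received -/
  suppression : ∀ i p μ, r.Broadcasts A i p μ →
    {j : Fin n | j ∉ r.byz ∧ ¬ ∃ k, r.event k = some (j, Input.recv i μ) ∧ r.src k = p}.ncard ≤ d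

/-- The properties of the MBRB abstraction, with global delivery to `ℓ` correct processes. -/
structure SatisfiesMBRB {n : ℕ} {D V : Type*} (r : Run n D V) (A : Algorithm n D V) (ℓ : ℕ) :
    Prop where
  validity : ∀ i j v sn, i ∉ r.byz → j ∉ r.byz → r.Delivers A i v sn j → r.Invokes j v sn
  no_duplication : ∀ i j v v' sn p p', i ∉ r.byz → r.DeliversAt A i p v sn j →
    r.DeliversAt A i p' v' sn j → p = p'
  no_duplicity : ∀ i i' j v v' sn, i ∉ r.byz → i' ∉ r.byz → i ≠ i' → r.Delivers A i v sn j →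
    r.Delivers A i' v' sn j → v = v'
  local_delivery : ∀ i v sn, i ∉ r.byz → r.Invokes i v sn → ∃ j, j ∉ r.byz ∧ r.Delivers A j v sn i
  global_delivery : ∀ i j v sn, i ∉ r.byz → r.Delivers A i v sn j →
    ℓ ≤ {i' : Fin n | i' ∉ r.byz ∧ r.Delivers A i' v sn j}.ncard

end Run

/-- `A` implements MBRB, with `ℓ = c - d` where `c` is the number of correct processes of the
run, in the presence of at most `t` Byzantine processes and a message adversary of power `d`. -/
def Algorithm.ImplementsMBRB {n : ℕ} {D V : Type*} (A : Algorithm n D V) (mode : SigMode)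
    (t d : ℕ) : Prop :=
  ∀ r : Run n D V, r.IsRunOf A mode t d → r.SatisfiesMBRB A (r.numCorrect - d)

end MBRB

/-! The proof is an indistinguishability argument. Since `n ≤ 3t + 2d`, the processes split into
`C`, `Q₁ ∪ D₁` and `Q₂ ∪ D₂`, with `C`, `Q₁`, `Q₂` of size at most `t` and `D₁`, `D₂` of size at
most `d` (`exists_groups`). Fix `s ∈ C` and two messages `v₁ ≠ v₂`.

In a first run, `s` broadcasts `v₁`, `Q₂` is Byzantine and silent, and the adversary suppresses
every copy for `D₂`. Being event-driven, `D₂` sends nothing; by validity it delivers nothing from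
`s` either. Local and global delivery give more than `|C|` correct deliverers, so some process of
`Q₁ ∪ D₁` delivers `v₁`, after hearing only from its own group and `C` (`exists_oneSided`). A
symmetric run makes a process of `Q₂ ∪ D₂` deliver `v₂`.

Now let `C` be Byzantine and play its first role towards one group, then its second role towards the
other, while messages between the groups are delayed (`splice`). This is feasible even with
signatures: whatever `C` sends in a one-sided run carries only signatures of `C` or ones sent
earlier by the group (`OneSided.sig_origin`). The finite prefix extends to a fair run
(`isRunOf_fairExtension`), where both deliveries violate no-duplicity. -/

namespace MBRB

namespace Run

/-! ### Finite prefixes of runs and their safety conditions -/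

section Prefixes

variable {n : ℕ} {D V : Type*}

/-- The local event of process `i` at time `k`, if any. -/
def localEvent (r : Run n D V) (i : Fin n) (k : ℕ) : Option (Input n D V) :=
  match r.event k with
  | none => none
  | some (i', x) => if i' = i then some x else none

theorem localEvent_eq_some {r : Run n D V} {i : Fin n} {k : ℕ} {x : Input n D V} :
    r.localEvent i k = some x ↔ r.event k = some (i, x) := by
  unfold localEvent
  rcases r.event k with _ | ⟨i', y⟩
  · simp
  · by_cases h : i' = i <;> simp [h]

theorem history_eq (r : Run n D V) (i : Fin n) (k : ℕ) :
    r.history i k = (List.range k).filterMap (r.localEvent i) := rfl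

theorem history_succ (r : Run n D V) (i : Fin n) (k : ℕ) :
    r.history i (k + 1) = r.history i k ++ (r.localEvent i k).toList := by
  rw [history_eq, history_eq, List.range_succ, List.filterMap_append]
  congr 1

theorem mem_history {r : Run n D V} {i : Fin n} {k : ℕ} {x : Input n D V} :
    x ∈ r.history i k ↔ ∃ k' < k, r.event k' = some (i, x) := by
  simp [history_eq, List.mem_filterMap, localEvent_eq_some]

theorem output_of_event {r : Run n D V} {A : Algorithm n D V} {k : ℕ} {i : Fin n}
    {x : Input n D V} (h : r.event k = some (i, x)) :
    r.output A k = A.react i (r.history i k) x := by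
  simp [output, h]

theorem history_congr {r r' : Run n D V} {i : Fin n} {k : ℕ}
    (h : ∀ k' < k, r.localEvent i k' = r'.localEvent i k') :
    r.history i k = r'.history i k := by
  induction k with
  | zero => rfl
  | succ k ih =>
    rw [history_succ, history_succ, ih fun k' hk' => h k' (by omega), h k (by omega)]

theorem output_congr {r r' : Run n D V} {A : Algorithm n D V} {k : ℕ}
    (h : ∀ k' ≤ k, r.event k' = r'.event k') : r.output A k = r'.output A k := by
  have hh : ∀ i, r.history i k = r'.history i k := fun i =>
    history_congr fun k' hk' => by simp [localEvent, h k' hk'.le]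
  unfold output
  simp only [hh, h k le_rfl]

theorem Broadcasts.congr {r r' : Run n D V} {A : Algorithm n D V} {i : Fin n} {p : ℕ × ℕ}
    {μ : Msg n D} (hb : r.Broadcasts A i p μ) (h : ∀ k' ≤ p.1, r.event k' = r'.event k') :
    r'.Broadcasts A i p μ := by
  obtain ⟨⟨x, hx⟩, hs⟩ := hb
  exact ⟨⟨x, by rw [← h _ le_rfl, hx]⟩, by rw [← output_congr h, hs]⟩

theorem Broadcasts.unique {r : Run n D V} {A : Algorithm n D V} {i i' : Fin n} {p : ℕ × ℕ}
    {μ μ' : Msg n D} (h : r.Broadcasts A i p μ) (h' : r.Broadcasts A i' p μ') :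
    i = i' ∧ μ = μ' := by
  obtain ⟨⟨x, hx⟩, hs⟩ := h
  obtain ⟨⟨x', hx'⟩, hs'⟩ := h'
  rw [hx] at hx'
  rw [hs] at hs'
  simp_all

theorem Broadcasts.mem_sends {r : Run n D V} {A : Algorithm n D V} {i : Fin n} {p : ℕ × ℕ}
    {μ : Msg n D} (h : r.Broadcasts A i p μ) : μ ∈ (r.output A p.1).sends :=
  List.mem_of_getElem? h.2

/-- The safety clauses of `IsRunOf`, required only before time `K`. -/
structure SafeBefore (r : Run n D V) (A : Algorithm n D V) (mode : SigMode) (K : ℕ) :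
    Prop where
  correct_steps : ∀ k < K, ∀ i x, r.event k = some (i, x) → i ∉ r.byz
  seq_once : ∀ k < K, ∀ k' < K, ∀ i v v' sn, r.event k = some (i, Input.invoke v sn) →
    r.event k' = some (i, Input.invoke v' sn) → k = k'
  recv_sent : ∀ k < K, ∀ i j μ, r.event k = some (j, Input.recv i μ) → i ∉ r.byz →
    (r.src k).1 < k ∧ r.Broadcasts A i (r.src k) μ
  recv_once : ∀ k < K, ∀ k' < K, ∀ i i' j μ μ', r.event k = some (j, Input.recv i μ) →
    r.event k' = some (j, Input.recv i' μ') → i ∉ r.byz → i' ∉ r.byz →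
    r.src k = r.src k' → k = k'
  recv_byz : ∀ k < K, ∀ i j μ, r.event k = some (j, Input.recv i μ) → i ∈ r.byz →
    CanSend mode (r.byz : Set (Fin n)) {μ' | ∃ k', k' < k ∧ μ' ∈ (r.output A k').sends} μ

end Prefixes

/-! ### Completing a safe prefix to a fair run -/

section FairExtension

variable {n : ℕ} {D V : Type*}

/-- The copy for `j` of the message with source `p` can be handed over at time `k`: it has been
broadcast by `im.1` with content `im.2`, and it has not been received. -/
def Pending (r : Run n D V) (A : Algorithm n D V) (k : ℕ) (p : ℕ × ℕ) (j : Fin n)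
    (im : Fin n × Msg n D) : Prop :=
  p.1 < k ∧ im.1 ∉ r.byz ∧ r.Broadcasts A im.1 p im.2 ∧
    ¬ ∃ k' < k, ∃ i' μ', r.event k' = some (j, Input.recv i' μ') ∧ i' ∉ r.byz ∧ r.src k' = p

open Classical in
/-- What the fair scheduler does in order to serve a task: a tick of a given process or the
transmission of a given copy, if it is pending. Nothing is transmitted to the processes in `blocked`. -/
noncomputable def serve (byz blocked : Finset (Fin n))
    (pending : ℕ × ℕ → Fin n → Fin n × Msg n D → Prop) :
    Option (Fin n ⊕ (ℕ × ℕ) × Fin n) → Option (Fin n × Input n D V) × (ℕ × ℕ)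
  | none => (none, (0, 0))
  | some (.inl i) => (if i ∈ byz then none else some (i, Input.tick), (0, 0))
  | some (.inr (p, j)) =>
    if h : j ∉ byz ∧ j ∉ blocked ∧ ∃ im, pending p j im then
      (some (j, Input.recv h.2.2.choose.1 h.2.2.choose.2), p)
    else (none, (0, 0))

/-- The part of a run strictly before time `k`. -/
def truncate (byz : Finset (Fin n)) (f : ℕ → Option (Fin n × Input n D V) × (ℕ × ℕ)) (k : ℕ) :
    Run n D V where
  byz := byz
  event k' := if k' < k then (f k').1 else none
  src k' := if k' < k then (f k').2 else (0, 0)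

/-- The task of the fair scheduler at time `k`. -/
def task (n : ℕ) (k : ℕ) : Option (Fin n ⊕ (ℕ × ℕ) × Fin n) :=
  Encodable.decode (Nat.unpair k).1

/-- The second component of the pairing is free, so each task recurs at arbitrarily late times; this
is the source of fairness. -/
theorem exists_task_eq (a : Fin n ⊕ (ℕ × ℕ) × Fin n) (m : ℕ) : ∃ k, m ≤ k ∧ task n k = some a :=
  ⟨Nat.pair (Encodable.encode a) m, Nat.right_le_pair _ _, by simp [task]⟩

/-- The steps of `r` before time `K`, followed by those of the fair scheduler. -/
noncomputable def fairSteps (r : Run n D V) (A : Algorithm n D V) (blocked : Finset (Fin n))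
    (K : ℕ) (k : ℕ) : Option (Fin n × Input n D V) × (ℕ × ℕ) :=
  if k < K then (r.event k, r.src k)
  else
    -- The inner test duplicates the one in `truncate`; it makes the decrease of the recursive
    -- argument visible to the termination check.
    let past := truncate r.byz (fun k' => if k' < k then fairSteps r A blocked K k'
      else (none, (0, 0))) k
    serve past.byz blocked (past.Pending A k) (task n k)
termination_by k

/-- The run that follows `r` before time `K` and the fair scheduler from then on. -/
noncomputable def fairExtension (r : Run n D V) (A : Algorithm n D V) (blocked : Finset (Fin n))
    (K : ℕ) : Run n D V where
  byz := r.byz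
  event k := (fairSteps r A blocked K k).1
  src k := (fairSteps r A blocked K k).2

variable {r r' : Run n D V} {A : Algorithm n D V} {mode : SigMode} {blocked : Finset (Fin n)}
  {K k : ℕ}

theorem Pending.congr {p : ℕ × ℕ} {j : Fin n} {im : Fin n × Msg n D} (hbyz : r.byz = r'.byz)
    (he : ∀ k' < k, r.event k' = r'.event k') (hs : ∀ k' < k, r.src k' = r'.src k')
    (h : r.Pending A k p j im) : r'.Pending A k p j im := by
  obtain ⟨h1, h2, h3, h4⟩ := h
  refine ⟨h1, hbyz ▸ h2, h3.congr fun k' hk' => he k' (by omega), ?_⟩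
  rintro ⟨k', hk', i', μ', h5, h6, h7⟩
  exact h4 ⟨k', hk', i', μ', by rw [he k' hk', h5], hbyz ▸ h6, by rw [hs k' hk', h7]⟩

theorem pending_congr (hbyz : r.byz = r'.byz) (he : ∀ k' < k, r.event k' = r'.event k')
    (hs : ∀ k' < k, r.src k' = r'.src k') :
    (r.Pending A k : ℕ × ℕ → Fin n → Fin n × Msg n D → Prop) = r'.Pending A k := by
  ext p j im
  exact ⟨Pending.congr hbyz he hs, Pending.congr hbyz.symm (fun k' h => (he k' h).symm)
    fun k' h => (hs k' h).symm⟩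

theorem fairExtension_event_of_lt (hk : k < K) :
    (r.fairExtension A blocked K).event k = r.event k := by
  simp only [fairExtension]
  rw [fairSteps, if_pos hk]

theorem fairExtension_src_of_lt (hk : k < K) :
    (r.fairExtension A blocked K).src k = r.src k := by
  simp only [fairExtension]
  rw [fairSteps, if_pos hk]

theorem fairExtension_of_le (hk : K ≤ k) :
    ((r.fairExtension A blocked K).event k, (r.fairExtension A blocked K).src k) =
      serve r.byz blocked ((r.fairExtension A blocked K).Pending A k) (task n k) := by
  simp only [fairExtension, Prod.mk.eta]
  rw [fairSteps, if_neg hk.not_gt]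
  refine congrArg (serve r.byz blocked · (task n k)) (pending_congr rfl ?_ ?_) <;>
    intro k' hk' <;> simp [truncate, hk']

/-- The steps of the fair scheduler. -/
inductive FairStep (r : Run n D V) (A : Algorithm n D V) (blocked : Finset (Fin n)) (k : ℕ) : Prop
  | idle (h : r.event k = none)
  | tick (i : Fin n) (hi : i ∉ r.byz) (h : r.event k = some (i, Input.tick))
  | recv (j i : Fin n) (μ : Msg n D) (hj : j ∉ r.byz) (hb : j ∉ blocked)
    (h : r.event k = some (j, Input.recv i μ)) (hp : r.Pending A k (r.src k) j (i, μ))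

theorem fairStep_of_serve {o : Option (Fin n ⊕ (ℕ × ℕ) × Fin n)}
    (h : (r.event k, r.src k) = serve r.byz blocked (r.Pending A k) o) : FairStep r A blocked k := by
  rcases o with _ | i | ⟨p, j⟩
  · exact .idle (congrArg Prod.fst h)
  · by_cases hi : i ∈ r.byz
    · exact .idle (by simpa [serve, hi] using congrArg Prod.fst h)
    · exact .tick i hi (by simpa [serve, hi] using congrArg Prod.fst h)
  · by_cases hc : j ∉ r.byz ∧ j ∉ blocked ∧ ∃ im, r.Pending A k p j im
    · simp only [serve, dif_pos hc, Prod.mk.injEq] at h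
      exact .recv j _ _ hc.1 hc.2.1 h.1 (by rw [h.2]; exact hc.2.2.choose_spec)
    · simp only [serve, dif_neg hc, Prod.mk.injEq] at h
      exact .idle h.1

theorem fairExtension_fairStep (hk : K ≤ k) :
    FairStep (r.fairExtension A blocked K) A blocked k :=
  fairStep_of_serve (fairExtension_of_le hk)

/-- After `K` the scheduler only ticks or hands over pending copies, so safety persists. Every
unblocked copy eventually gets its turn, hence only copies for `blocked` can be lost. Byzantine
processes stay silent from `K` on. -/
theorem isRunOf_fairExtension {t d : ℕ} (hs : r.SafeBefore A mode K) (ht : r.byz.card ≤ t)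
    (hd : blocked.card ≤ d) : (r.fairExtension A blocked K).IsRunOf A mode t d := by
  have hbyz : (r.fairExtension A blocked K).byz = r.byz := rfl
  have hev := fun k (hk : k < K) =>
    fairExtension_event_of_lt (r := r) (A := A) (blocked := blocked) hk
  have hsrc := fun k (hk : k < K) =>
    fairExtension_src_of_lt (r := r) (A := A) (blocked := blocked) hk
  have hfair := fun k (hk : K ≤ k) =>
    fairExtension_fairStep (r := r) (A := A) (blocked := blocked) hk
  have hserve := fun k (hk : K ≤ k) =>
    fairExtension_of_le (r := r) (A := A) (blocked := blocked) hk
  generalize r.fairExtension A blocked K = R at *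
  have hcorrect : ∀ k i x, R.event k = some (i, x) → i ∉ R.byz := by
    intro k i x h
    rcases lt_or_ge k K with hk | hk
    · rw [hev k hk] at h
      exact hbyz ▸ hs.correct_steps k hk i x h
    · rcases hfair k hk with h' | ⟨i', hi, h'⟩ | ⟨j, i', μ, hj, -, h', -⟩ <;> rw [h] at h'
      · cases h'
      · cases h'; exact hi
      · cases h'; exact hj
  have hrecv : ∀ k i j μ, R.event k = some (j, Input.recv i μ) → i ∉ R.byz →
      (R.src k).1 < k ∧ R.Broadcasts A i (R.src k) μ := by
    intro k i j μ h hi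
    rcases lt_or_ge k K with hk | hk
    · rw [hev k hk] at h
      rw [hbyz] at hi
      obtain ⟨h1, h2⟩ := hs.recv_sent k hk i j μ h hi
      rw [hsrc k hk]
      exact ⟨h1, h2.congr fun k' hk' => (hev k' (by omega)).symm⟩
    · rcases hfair k hk with h' | ⟨i', hi, h'⟩ | ⟨j, i', μ, hj, -, h', hp⟩ <;> rw [h] at h'
      · cases h'
      · cases h'
      · cases h'; exact ⟨hp.1, hp.2.2.1⟩
  have honce : ∀ k k' i i' j μ μ', k < k' → R.event k = some (j, Input.recv i μ) →
      R.event k' = some (j, Input.recv i' μ') → i ∉ R.byz → i' ∉ R.byz →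
      R.src k ≠ R.src k' := by
    intro k k' i i' j μ μ' hkk h h' hi hi' he
    rcases lt_or_ge k' K with hk' | hk'
    · rw [hev _ (hkk.trans hk')] at h
      rw [hev _ hk'] at h'
      rw [hsrc _ (hkk.trans hk'), hsrc _ hk'] at he
      exact hkk.ne (hs.recv_once k (hkk.trans hk') k' hk' i i' j μ μ' h h' (hbyz ▸ hi)
        (hbyz ▸ hi') he)
    · rcases hfair k' hk' with h1 | ⟨i1, -, h1⟩ | ⟨j1, i1, μ1, -, -, h1, hp⟩ <;> rw [h'] at h1
      · cases h1
      · cases h1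
      · cases h1; exact hp.2.2.2 ⟨k, hkk, i, μ, h, hi, he⟩
  refine ⟨hbyz ▸ ht, hcorrect, ?_, ?_, hrecv, ?_, ?_, ?_⟩
  · have key : ∀ k i v sn, R.event k = some (i, Input.invoke v sn) → k < K := by
      intro k i v sn h
      by_contra hk
      rcases hfair k (not_lt.1 hk) with h1 | ⟨i1, -, h1⟩ | ⟨j1, i1, μ1, -, -, h1, hp⟩ <;>
        rw [h] at h1 <;> cases h1
    intro k k' i v v' sn h h'
    have hk := key _ _ _ _ h
    have hk' := key _ _ _ _ h'
    exact hs.seq_once k hk k' hk' i v v' sn (hev k hk ▸ h) (hev k' hk' ▸ h')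
  · intro i hi k
    obtain ⟨k', hk', hT⟩ := exists_task_eq (n := n) (.inl i) (max k K)
    refine ⟨k', by omega, ?_⟩
    have := congrArg Prod.fst (hserve k' (by omega))
    rw [hbyz] at hi
    simpa [hT, serve, hi] using this
  · intro k k' i i' j μ μ' h h' hi hi' he
    rcases lt_trichotomy k k' with hl | hl | hl
    · exact (honce _ _ _ _ _ _ _ hl h h' hi hi' he).elim
    · exact hl
    · exact (honce _ _ _ _ _ _ _ hl h' h hi' hi he.symm).elim
  · intro k i j μ h hi
    rcases lt_or_ge k K with hk | hk
    · rw [hev k hk] at h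
      have := hs.recv_byz k hk i j μ h (hbyz ▸ hi)
      have he : {μ' | ∃ k' < k, μ' ∈ (R.output A k').sends} =
          {μ' | ∃ k' < k, μ' ∈ (r.output A k').sends} := by
        ext μ'
        refine exists_congr fun k' => and_congr_right fun hk' => ?_
        rw [output_congr (r := R) (r' := r) fun m hm => hev m (by omega)]
      rwa [he, hbyz]
    · rcases hfair k hk with h' | ⟨i', -, h'⟩ | ⟨j, i', μ, hj, -, h', hp⟩ <;> rw [h] at h'
      · cases h'
      · cases h'
      · cases h'; exact (hp.2.1 hi).elim
  · intro i p μ hb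
    have hi : i ∉ R.byz := by
      obtain ⟨⟨x, hx⟩, -⟩ := hb
      exact hcorrect _ _ _ hx
    refine le_trans ?_ hd
    rw [← Set.ncard_coe_finset]
    refine Set.ncard_le_ncard ?_ (Finset.finite_toSet _)
    rintro j ⟨hj, hno⟩
    by_contra hjb
    obtain ⟨k, hk, hT⟩ := exists_task_eq (n := n) (.inr (p, j)) (max K (p.1 + 1))
    apply hno
    -- At its turn the copy has either been received already or is pending and is handed over now.
    by_cases hold : ∃ k' < k, ∃ i' μ', R.event k' = some (j, Input.recv i' μ') ∧ i' ∉ R.byz ∧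
        R.src k' = p
    · obtain ⟨k', -, i', μ', h1, h2, h3⟩ := hold
      obtain ⟨rfl, rfl⟩ := hb.unique (h3 ▸ (hrecv _ _ _ _ h1 h2).2)
      exact ⟨k', h1, h3⟩
    · have hc : j ∉ R.byz ∧ j ∉ blocked ∧ ∃ im, R.Pending A k p j im :=
        ⟨hj, hjb, (i, μ), by omega, hi, hb, hold⟩
      have hv := hserve k (by omega)
      rw [← hbyz] at hv
      simp only [hT, serve, dif_pos hc, Prod.mk.injEq] at hv
      obtain ⟨h1, h2⟩ := hb.unique hc.2.2.choose_spec.2.2.1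
      exact ⟨k, by rw [hv.1, ← h1, ← h2], hv.2⟩

end FairExtension

/-! ### Gluing two one-sided runs -/

section Splicing

variable {n : ℕ} {D V : Type*}

/-- Between times `o` and `o + K`, the processes of `G` do in `r` what they do in `r₁` before
time `K`, and they do nothing earlier. -/
structure Embeds (r r₁ : Run n D V) (G : Finset (Fin n)) (o K : ℕ) : Prop where
  before : ∀ k < o, ∀ i ∈ G, ∀ x, r.event k ≠ some (i, x)
  event : ∀ k < K, ∀ i ∈ G, ∀ x, r.event (o + k) = some (i, x) ↔ r₁.event k = some (i, x)
  src : ∀ k < K, r.src (o + k) = (o + (r₁.src k).1, (r₁.src k).2)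

/-- In `r`, every reception is from a correct process of `G ∪ C`, and every invocation is in
`C`. -/
structure OneSided (r : Run n D V) (G C : Finset (Fin n)) : Prop where
  recv_from : ∀ k i j μ, r.event k = some (j, Input.recv i μ) → i ∉ r.byz ∧ (i ∈ G ∨ i ∈ C)
  invoke_by : ∀ k i v sn, r.event k = some (i, Input.invoke v sn) → i ∈ C

variable {r r₁ r₂ : Run n D V} {A : Algorithm n D V} {mode : SigMode} {G G₁ G₂ C : Finset (Fin n)}
  {o K K₁ K₂ t d : ℕ}

/-- Local histories do not record global time, so a shifted process cannot tell the two runs apart.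
-/
theorem Embeds.history_eq (h : Embeds r r₁ G o K) {i : Fin n} (hi : i ∈ G) {k : ℕ} (hk : k ≤ K) :
    r.history i (o + k) = r₁.history i k := by
  induction k with
  | zero =>
    rw [show r₁.history i 0 = [] from rfl, List.eq_nil_iff_forall_not_mem]
    intro x hx
    obtain ⟨k', hk', he⟩ := mem_history.1 hx
    exact h.before k' hk' i hi x he
  | succ k ih =>
    rw [← add_assoc, history_succ, history_succ, ih (by omega)]
    congr 2
    ext x
    rw [localEvent_eq_some, localEvent_eq_some, h.event k (by omega) i hi]

theorem Embeds.output_eq (h : Embeds r r₁ G o K) {i : Fin n} (hi : i ∈ G) {k : ℕ} (hk : k < K)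
    {x : Input n D V} (he : r₁.event k = some (i, x)) :
    r.output A (o + k) = r₁.output A k := by
  rw [output_of_event he, output_of_event ((h.event k hk i hi x).2 he), h.history_eq hi hk.le]

theorem Embeds.broadcasts (h : Embeds r r₁ G o K) {i : Fin n} (hi : i ∈ G) {p : ℕ × ℕ}
    (hp : p.1 < K) {μ : Msg n D} (hb : r₁.Broadcasts A i p μ) :
    r.Broadcasts A i (o + p.1, p.2) μ := by
  obtain ⟨⟨x, hx⟩, hs⟩ := hb
  exact ⟨⟨x, (h.event _ hp i hi x).2 hx⟩, by rw [h.output_eq hi hp hx, hs]⟩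

theorem Embeds.deliversAt (h : Embeds r r₁ G o K) {i j : Fin n} (hi : i ∈ G) {p : ℕ × ℕ}
    (hp : p.1 < K) {v : V} {sn : ℕ} (hb : r₁.DeliversAt A i p v sn j) :
    r.DeliversAt A i (o + p.1, p.2) v sn j := by
  obtain ⟨⟨x, hx⟩, hs⟩ := hb
  exact ⟨⟨x, (h.event _ hp i hi x).2 hx⟩, by rw [h.output_eq hi hp hx, hs]⟩

/-- In a one-sided run, a signature sent by `C` is by a process of `C`, or it has been sent
before by `G`. -/
theorem OneSided.sig_origin (hr : r₁.IsRunOf A .signatureBased t d) (h₁ : r₁.OneSided G C)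
    (hA : A.RespectsSignatures .signatureBased) (a : Fin n) (b : Msg n D) (k : ℕ) :
    ∀ i ∈ C, ∀ x, r₁.event k = some (i, x) → ∀ μ ∈ (r₁.output A k).sends, (a, b) ∈ μ.sigs →
      a ∈ C ∨ ∃ k' < k, ∃ i' ∈ G, ∃ x', r₁.event k' = some (i', x') ∧
        ∃ μ' ∈ (r₁.output A k').sends, (a, b) ∈ μ'.sigs := by
  induction k using Nat.strong_induction_on with
  | _ k ih =>
    intro i hi x he μ hμ hab
    rw [output_of_event he] at hμ
    rcases hA i _ x μ hμ a b hab with h | ⟨μ', ⟨j, hj⟩, hab'⟩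
    · rw [Set.mem_singleton_iff.1 h]
      exact .inl hi
    -- The reception being processed counts as received, hence `≤`; its source is strictly earlier,
    -- so the induction applies.
    · have hrec : ∃ m ≤ k, r₁.event m = some (i, Input.recv j μ') := by
        rcases List.mem_append.1 hj with hj | hj
        · obtain ⟨m, hm, hme⟩ := mem_history.1 hj
          exact ⟨m, hm.le, hme⟩
        · exact ⟨k, le_rfl, by rw [List.mem_singleton.1 hj, he]⟩
      obtain ⟨m, hm, hme⟩ := hrec
      obtain ⟨hjb, hjG⟩ := h₁.recv_from m j i μ' hme
      obtain ⟨hlt, hb⟩ := hr.recv_sent m j i μ' hme hjb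
      have hs := hb.mem_sends
      obtain ⟨⟨y, hy⟩, -⟩ := hb
      rcases hjG with hjG | hjC
      · exact .inr ⟨_, by omega, j, hjG, y, hy, μ', hs, hab'⟩
      · rcases ih _ (by omega) j hjC y hy μ' hs hab' with h | ⟨k', hk', h⟩
        · exact .inl h
        · exact .inr ⟨k', by omega, h⟩

theorem Embeds.recv_sent (h : Embeds r r₁ G o K) (hr : r₁.IsRunOf A mode t d)
    (h₁ : r₁.OneSided G C) {k : ℕ} (hk : k < K) {i j : Fin n} {μ : Msg n D}
    (he : r₁.event k = some (j, Input.recv i μ)) (hi : i ∉ C) :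
    (r.src (o + k)).1 < o + k ∧ r.Broadcasts A i (r.src (o + k)) μ := by
  obtain ⟨hib, hiG⟩ := h₁.recv_from k i j μ he
  obtain ⟨hlt, hb⟩ := hr.recv_sent k i j μ he hib
  rw [h.src k hk]
  exact ⟨by simpa using hlt, h.broadcasts (hiG.resolve_right hi) (hlt.trans hk) hb⟩

/-- A message from `C`, honest in `r₁`, can be replayed by a Byzantine `C`: the foreign signatures
in it come from earlier broadcasts of `G`, which also occur in `r`. -/
theorem Embeds.recv_byz (h : Embeds r r₁ G o K) (hr : r₁.IsRunOf A mode t d)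
    (h₁ : r₁.OneSided G C) (hA : A.RespectsSignatures mode) {k : ℕ} (hk : k < K) {i j : Fin n}
    {μ : Msg n D} (he : r₁.event k = some (j, Input.recv i μ)) (hi : i ∈ C) :
    CanSend mode (C : Set (Fin n))
      {μ' | ∃ k', k' < o + k ∧ μ' ∈ (r.output A k').sends} μ := by
  cases mode with
  | signatureFree => trivial
  | signatureBased =>
    intro a b hab
    obtain ⟨hlt, hb⟩ := hr.recv_sent k i j μ he (h₁.recv_from k i j μ he).1
    have hs := hb.mem_sends
    obtain ⟨⟨y, hy⟩, -⟩ := hb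
    rcases h₁.sig_origin hr hA a b _ i hi y hy μ hs hab with
      h' | ⟨k', hk', i', hi', x', hx', μ', hμ', hab'⟩
    · exact .inl h'
    · refine .inr ⟨μ', ⟨o + k', by omega, ?_⟩, hab'⟩
      rwa [h.output_eq hi' (by omega) hx']

theorem Embeds.recv_once (h : Embeds r r₁ G o K) (hr : r₁.IsRunOf A mode t d)
    (h₁ : r₁.OneSided G C) {k k' : ℕ} (hk : k < K) (hk' : k' < K) {i i' j : Fin n}
    {μ μ' : Msg n D} (he : r₁.event k = some (j, Input.recv i μ))
    (he' : r₁.event k' = some (j, Input.recv i' μ'))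
    (hs : r.src (o + k) = r.src (o + k')) : k = k' := by
  refine hr.recv_once k k' i i' j μ μ' he he' (h₁.recv_from _ _ _ _ he).1
    (h₁.recv_from _ _ _ _ he').1 ?_
  rw [h.src k hk, h.src k' hk'] at hs
  simpa [Prod.ext_iff] using hs

/-- The processes of `G₁` follow `r₁` for `K₁` units of time, then those of `G₂` follow `r₂` for
`K₂` units of time, and those of `C` are Byzantine. -/
def splice (r₁ r₂ : Run n D V) (G₁ G₂ C : Finset (Fin n)) (K₁ K₂ : ℕ) : Run n D V where
  byz := C
  event k :=
    if k < K₁ then (r₁.event k).filter fun e => e.1 ∈ G₁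
    else if k < K₁ + K₂ then (r₂.event (k - K₁)).filter fun e => e.1 ∈ G₂
    else none
  src k := if k < K₁ then r₁.src k else (K₁ + (r₂.src (k - K₁)).1, (r₂.src (k - K₁)).2)

theorem splice_event_cases {k : ℕ} {i : Fin n} {x : Input n D V}
    (h : (splice r₁ r₂ G₁ G₂ C K₁ K₂).event k = some (i, x)) :
    (k < K₁ ∧ i ∈ G₁ ∧ r₁.event k = some (i, x)) ∨
      ∃ m < K₂, k = K₁ + m ∧ i ∈ G₂ ∧ r₂.event m = some (i, x) := by
  simp only [splice] at h
  split_ifs at h with h1 h2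
  · obtain ⟨he, hi⟩ := Option.filter_eq_some_iff.1 h
    exact .inl ⟨h1, by simpa using hi, he⟩
  · obtain ⟨he, hi⟩ := Option.filter_eq_some_iff.1 h
    exact .inr ⟨k - K₁, by omega, by omega, by simpa using hi, he⟩

theorem embeds_splice_left (K₂ : ℕ) :
    Embeds (splice r₁ r₂ G₁ G₂ C K₁ K₂) r₁ G₁ 0 K₁ where
  before k hk := absurd hk (Nat.not_lt_zero _)
  event k hk i hi x := by
    simp only [splice, Nat.zero_add, if_pos hk, Option.filter_eq_some_iff]
    simp [hi]
  src k hk := by simp [splice, hk]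

theorem embeds_splice_right (hG : Disjoint G₁ G₂) :
    Embeds (splice r₁ r₂ G₁ G₂ C K₁ K₂) r₂ G₂ K₁ K₂ where
  before k hk i hi x he := by
    rcases splice_event_cases he with ⟨-, h, -⟩ | ⟨m, -, h, -⟩
    · exact Finset.disjoint_left.1 hG h hi
    · omega
  event k hk i hi x := by
    simp only [splice, Nat.add_sub_cancel_left, Option.filter_eq_some_iff,
      if_neg (show ¬ K₁ + k < K₁ by omega), if_pos (show K₁ + k < K₁ + K₂ by omega)]
    simp [hi]
  src k hk := by simp [splice]

/-- Each reception within a group inherits its legality from the original run, and each one from `C`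
becomes Byzantine. Invocations belonged to `C`, so none remain. -/
theorem safeBefore_splice (hA : A.RespectsSignatures mode) (hr₁ : r₁.IsRunOf A mode t d)
    (hr₂ : r₂.IsRunOf A mode t d) (h₁ : r₁.OneSided G₁ C) (h₂ : r₂.OneSided G₂ C)
    (hG : Disjoint G₁ G₂) (hG₁ : Disjoint G₁ C) (hG₂ : Disjoint G₂ C) :
    (splice r₁ r₂ G₁ G₂ C K₁ K₂).SafeBefore A mode (K₁ + K₂) := by
  have e₁ : Embeds (splice r₁ r₂ G₁ G₂ C K₁ K₂) r₁ G₁ 0 K₁ := embeds_splice_left K₂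
  have e₂ : Embeds (splice r₁ r₂ G₁ G₂ C K₁ K₂) r₂ G₂ K₁ K₂ := embeds_splice_right hG
  have hbyz : (splice r₁ r₂ G₁ G₂ C K₁ K₂).byz = C := rfl
  have hcases := fun k i x =>
    splice_event_cases (r₁ := r₁) (r₂ := r₂) (G₁ := G₁) (G₂ := G₂) (C := C) (K₁ := K₁) (K₂ := K₂)
      (k := k) (i := i) (x := x)
  generalize splice r₁ r₂ G₁ G₂ C K₁ K₂ = R at *
  refine ⟨?_, ?_, ?_, ?_, ?_⟩
  · intro k _ i x h
    rw [hbyz]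
    rcases hcases k i x h with ⟨-, hi, -⟩ | ⟨m, -, -, hi, -⟩
    · exact Finset.disjoint_left.1 hG₁ hi
    · exact Finset.disjoint_left.1 hG₂ hi
  · intro k _ k' _ i v v' sn h
    rcases hcases k i _ h with ⟨-, hi, he⟩ | ⟨m, -, -, hi, he⟩
    · exact (Finset.disjoint_left.1 hG₁ hi (h₁.invoke_by _ _ _ _ he)).elim
    · exact (Finset.disjoint_left.1 hG₂ hi (h₂.invoke_by _ _ _ _ he)).elim
  · intro k _ i j μ h hi
    rw [hbyz] at hi
    rcases hcases k j _ h with ⟨hk, -, he⟩ | ⟨m, hm, rfl, -, he⟩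
    · simpa using e₁.recv_sent hr₁ h₁ hk he hi
    · exact e₂.recv_sent hr₂ h₂ hm he hi
  · intro k _ k' _ i i' j μ μ' h h' _ _ hs
    rcases hcases k j _ h with ⟨hk, hj, he⟩ | ⟨m, hm, rfl, hj, he⟩ <;>
      rcases hcases k' j _ h' with ⟨hk', hj', he'⟩ | ⟨m', hm', rfl, hj', he'⟩
    · exact e₁.recv_once hr₁ h₁ hk hk' he he' (by simpa using hs)
    · exact (Finset.disjoint_left.1 hG hj hj').elim
    · exact (Finset.disjoint_left.1 hG hj' hj).elim
    · rw [e₂.recv_once hr₂ h₂ hm hm' he he' hs]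
  · intro k _ i j μ h hi
    rw [hbyz] at hi ⊢
    rcases hcases k j _ h with ⟨hk, -, he⟩ | ⟨m, hm, rfl, -, he⟩
    · simpa using e₁.recv_byz hr₁ h₁ hA hk he hi
    · exact e₂.recv_byz hr₂ h₂ hA hm he hi

end Splicing

/-! ### Runs in which one group is cut off -/

section OneSidedRuns

variable {n : ℕ} {D V : Type*}

/-- The run in which only the spontaneous local steps of `r` are kept. -/
def onlyTicks (r : Run n D V) : Run n D V where
  byz := r.byz
  event k := match r.event k with
    | some (i, .tick) => some (i, .tick)
    | _ => none
  src _ := (0, 0)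

variable {r : Run n D V} {A : Algorithm n D V} {mode : SigMode} {t d : ℕ}

theorem onlyTicks_event {k : ℕ} {i : Fin n} {x : Input n D V} :
    r.onlyTicks.event k = some (i, x) ↔ r.event k = some (i, x) ∧ x = .tick := by
  simp only [onlyTicks]
  rcases r.event k with _ | ⟨i', _ | _ | _⟩ <;> simp
  · rintro - rfl; simp
  · rintro - rfl; simp
  · rintro rfl; exact Eq.symm

theorem isRunOf_onlyTicks (hA : A.EventDriven) (hr : r.IsRunOf A mode t d) :
    r.onlyTicks.IsRunOf A mode t d where
  byz_card := hr.byz_card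
  correct_steps k i x h := hr.correct_steps k i x (onlyTicks_event.1 h).1
  seq_once k k' i v v' sn h := nomatch (onlyTicks_event.1 h).2
  never_stops i hi k := by
    obtain ⟨k', hk', h⟩ := hr.never_stops i hi k
    exact ⟨k', hk', onlyTicks_event.2 ⟨h, rfl⟩⟩
  recv_sent k i j μ h := nomatch (onlyTicks_event.1 h).2
  recv_once k k' i i' j μ μ' h := nomatch (onlyTicks_event.1 h).2
  recv_byz k i j μ h := nomatch (onlyTicks_event.1 h).2
  -- Nothing is broadcast on ticks, so nothing can be suppressed.
  suppression i p μ hb := by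
    obtain ⟨⟨x, hx⟩, hs⟩ := hb
    obtain ⟨-, rfl⟩ := onlyTicks_event.1 hx
    simp [output_of_event hx, hA i] at hs

/-- A correct process that takes only spontaneous steps does not deliver anything from a correct
process. -/
theorem not_delivers_of_only_ticks (hA : A.EventDriven) (hM : A.ImplementsMBRB mode t d)
    (hr : r.IsRunOf A mode t d) {i j : Fin n} (hi : i ∉ r.byz) (hj : j ∉ r.byz)
    (htick : ∀ k x, r.event k = some (i, x) → x = .tick) (v : V) (sn : ℕ) :
    ¬ r.Delivers A i v sn j := by
  rintro ⟨p, ⟨x, hx⟩, hd⟩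
  have hev : ∀ k x, r.onlyTicks.event k = some (i, x) ↔ r.event k = some (i, x) := fun k x =>
    onlyTicks_event.trans (and_iff_left_of_imp (htick k x))
  have hh : r.onlyTicks.history i p.1 = r.history i p.1 := history_congr fun k _ => by
    ext x
    rw [localEvent_eq_some, localEvent_eq_some, hev]
  have hdel : r.onlyTicks.Delivers A i v sn j := by
    refine ⟨p, ⟨x, (hev _ _).2 hx⟩, ?_⟩
    rw [output_of_event ((hev _ _).2 hx), hh, ← output_of_event hx, hd]
  obtain ⟨k, hk⟩ := (hM _ (isRunOf_onlyTicks hA hr)).validity i j v sn hi hj hdel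
  exact nomatch (onlyTicks_event.1 hk).2

/-- The run in which `s` invokes the broadcast of `v` at time `0`, and nothing else happens. -/
def singleInvocation (D : Type*) (byz : Finset (Fin n)) (s : Fin n) (v : V) : Run n D V where
  byz := byz
  event k := if k = 0 then some (s, .invoke v 0) else none
  src _ := (0, 0)

theorem safeBefore_singleInvocation {byz : Finset (Fin n)} {s : Fin n} (hs : s ∉ byz) (v : V) :
    (singleInvocation D byz s v).SafeBefore A mode 1 := by
  refine ⟨?_, ?_, ?_, ?_, ?_⟩
  · intro k hk i x h
    obtain rfl : k = 0 := by omega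
    simp only [singleInvocation, if_pos, Option.some.injEq, Prod.mk.injEq] at h
    exact h.1 ▸ hs
  · intro k hk k' hk'
    omega
  all_goals
    intro k hk
    obtain rfl : k = 0 := by omega
    simp [singleInvocation]

/-- If the processes of `byz` are silent and those of `blocked` receive nothing, a broadcast by
`s ∈ C` leads to a delivery in `G`. -/
theorem exists_oneSided (hA : A.EventDriven) (hM : A.ImplementsMBRB mode t d)
    {G C byz blocked : Finset (Fin n)} {s : Fin n} (hsC : s ∈ C) (hsbyz : s ∉ byz)
    (hsblocked : s ∉ blocked) (hcover : ∀ i, i ∈ G ∨ i ∈ C ∨ i ∈ byz ∨ i ∈ blocked)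
    (hbyz : byz.card ≤ t) (hblocked : blocked.card ≤ d) (hcard : C.card + d + byz.card < n)
    (v : V) :
    ∃ r : Run n D V, r.IsRunOf A mode t d ∧ r.OneSided G C ∧ ∃ a ∈ G, r.Delivers A a v 0 s := by
  have hr : ((singleInvocation D byz s v).fairExtension A blocked 1).IsRunOf A mode t d :=
    isRunOf_fairExtension (safeBefore_singleInvocation hsbyz v) hbyz hblocked
  have hfair := fun k (hk : 1 ≤ k) =>
    fairExtension_fairStep (r := singleInvocation D byz s v) (A := A) (blocked := blocked) hk
  have hzero : ((singleInvocation D byz s v).fairExtension A blocked 1).event 0 =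
      some (s, .invoke v 0) := fairExtension_event_of_lt Nat.one_pos
  have hb : ((singleInvocation D byz s v).fairExtension A blocked 1).byz = byz := rfl
  generalize (singleInvocation D byz s v).fairExtension A blocked 1 = r at *
  have htick : ∀ i ∈ blocked, ∀ k x, r.event k = some (i, x) → x = .tick := by
    intro i hi k x h
    rcases Nat.eq_zero_or_pos k with rfl | hk
    · rw [hzero] at h
      cases h
      exact (hsblocked hi).elim
    · rcases hfair k hk with h' | ⟨i', -, h'⟩ | ⟨j, i', μ, -, hj, h', -⟩ <;> rw [h] at h' <;> cases h'
      · rfl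
      · exact (hj hi).elim
  have hone : r.OneSided G C := by
    constructor
    · intro k i j μ h
      rcases Nat.eq_zero_or_pos k with rfl | hk
      · rw [hzero] at h
        cases h
      · rcases hfair k hk with h' | ⟨i', -, h'⟩ | ⟨j', i', μ', -, -, h', hp⟩ <;> rw [h] at h' <;>
          cases h'
        obtain ⟨-, hi, ⟨⟨x, hx⟩, hs⟩, -⟩ := hp
        refine ⟨hi, ?_⟩
        -- A blocked process only ticks, so it never broadcasts and cannot be the source.
        have hnb : i ∉ blocked := by
          intro hib
          obtain rfl := htick i hib _ _ hx
          simp [output_of_event hx, hA i] at hs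
        rcases hcover i with h | h | h | h
        · exact .inl h
        · exact .inr h
        · exact (hi (hb ▸ h)).elim
        · exact (hnb h).elim
    · intro k i w sn h
      rcases Nat.eq_zero_or_pos k with rfl | hk
      · rw [hzero] at h
        cases h
        exact hsC
      · rcases hfair k hk with h' | ⟨i', -, h'⟩ | ⟨j', i', μ', -, -, h', hp⟩ <;> rw [h] at h' <;>
          cases h'
  refine ⟨r, hr, hone, ?_⟩
  have hsat := hM r hr
  obtain ⟨j, hj, hdel⟩ := hsat.local_delivery s v 0 (hb ▸ hsbyz) ⟨0, hzero⟩
  have hge := hsat.global_delivery j s v 0 hj hdel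
  -- `hcard` says exactly that `ℓ = n - byz.card - d` exceeds the size of `C`.
  have hlt : (C : Set (Fin n)).ncard < {i : Fin n | i ∉ r.byz ∧ r.Delivers A i v 0 s}.ncard := by
    rw [Set.ncard_coe_finset]
    refine lt_of_lt_of_le ?_ hge
    rw [numCorrect, hb]
    omega
  obtain ⟨a, ⟨hab, had⟩, haC⟩ := Set.exists_mem_notMem_of_ncard_lt_ncard hlt
  refine ⟨a, ?_, had⟩
  rcases hcover a with h | h | h | h
  · exact h
  · exact (haC h).elim
  · exact (hab (hb ▸ h)).elim
  · exact (not_delivers_of_only_ticks hA hM hr hab (hb ▸ hsbyz) (htick a h) v 0 had).elim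

end OneSidedRuns

end Run

/-! ### Choice of the groups -/

theorem exists_group_sizes {n t d : ℕ} (hn3 : 3 ≤ n) (ht : 1 ≤ t) (hd : d + t < n)
    (hn : n ≤ 3 * t + 2 * d) :
    ∃ c q₁ q₂ d₁ d₂ : ℕ, c + q₁ + d₁ + q₂ + d₂ = n ∧ 1 ≤ c ∧ c ≤ t ∧ q₁ ≤ t ∧ q₂ ≤ t ∧ d₁ ≤ d ∧
      d₂ ≤ d ∧ c + d + q₁ < n ∧ c + d + q₂ < n := by
  rcases le_or_gt (2 * t + 2 * d + 1) n with h | h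
  -- Large `n`: the other groups are full and `C` takes the remainder, at most `t`. Otherwise `C` is
  -- a singleton and the rest is halved, using `Q₁`, `Q₂` only when `D₁`, `D₂` do not suffice.
  · exact ⟨n - 2 * t - 2 * d, t, t, d, d, by omega⟩
  · rcases le_or_gt (n - 1) (2 * d) with h' | h'
    · exact ⟨1, 0, 0, (n - 1) / 2, n - 1 - (n - 1) / 2, by omega⟩
    · exact ⟨1, (n - 1 - 2 * d) / 2, n - 1 - 2 * d - (n - 1 - 2 * d) / 2, d, d, by omega⟩

theorem exists_groups {n t d : ℕ} (hn3 : 3 ≤ n) (ht : 1 ≤ t) (hd : d + t < n)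
    (hn : n ≤ 3 * t + 2 * d) :
    ∃ (s : Fin n) (C Q₁ D₁ Q₂ D₂ : Finset (Fin n)), s ∈ C ∧ C.card ≤ t ∧
      Q₁.card ≤ t ∧ Q₂.card ≤ t ∧ D₁.card ≤ d ∧ D₂.card ≤ d ∧
      C.card + d + Q₁.card < n ∧ C.card + d + Q₂.card < n ∧
      (∀ i, i ∈ C ∨ i ∈ Q₁ ∪ D₁ ∨ i ∈ Q₂ ∪ D₂) ∧
      Disjoint (Q₁ ∪ D₁) (Q₂ ∪ D₂) ∧ Disjoint (Q₁ ∪ D₁) C ∧ Disjoint (Q₂ ∪ D₂) C := by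
  obtain ⟨c, q₁, q₂, d₁, d₂, hsum, hc, h⟩ := exists_group_sizes hn3 ht hd hn
  have key : ∀ a m : ℕ, a + m ≤ n → ∃ S : Finset (Fin n), S.card = m ∧
      ∀ i : Fin n, i ∈ S ↔ a ≤ i.val ∧ i.val < a + m := by
    intro a m ham
    refine ⟨(Finset.Ico a (a + m)).attachFin fun i hi => ?_, by simp, by simp⟩
    rw [Finset.mem_Ico] at hi
    omega
  obtain ⟨C, hC, mC⟩ := key 0 c (by omega)
  obtain ⟨Q₁, hQ₁, mQ₁⟩ := key c q₁ (by omega)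
  obtain ⟨D₁, hD₁, mD₁⟩ := key (c + q₁) d₁ (by omega)
  obtain ⟨Q₂, hQ₂, mQ₂⟩ := key (c + q₁ + d₁) q₂ (by omega)
  obtain ⟨D₂, hD₂, mD₂⟩ := key (c + q₁ + d₁ + q₂) d₂ (by omega)
  refine ⟨⟨0, by omega⟩, C, Q₁, D₁, Q₂, D₂, (mC _).2 ⟨le_rfl, by dsimp only; omega⟩, by omega,
    by omega, by omega, by omega, by omega, by omega, by omega, fun i => ?_, ?_, ?_, ?_⟩
  · have := i.isLt
    simp only [Finset.mem_union, mC, mQ₁, mQ₂, mD₁, mD₂]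
    omega
  all_goals
    rw [Finset.disjoint_left]
    intro i
    simp only [Finset.mem_union, mC, mQ₁, mQ₂, mD₁, mD₂]
    omega

end MBRB

/-! ### The contradiction -/

open MBRB MBRB.Run in
theorem theorem2 {D V : Type*} [Nontrivial V] (mode : MBRB.SigMode) (n t d : ℕ)
    (hn3 : 3 ≤ n) (ht : 1 ≤ t) (hd : d + t < n) (hn : n ≤ 3 * t + 2 * d) :
    ¬ ∃ A : MBRB.Algorithm n D V,
      A.RespectsSignatures mode ∧ A.EventDriven ∧ A.ImplementsMBRB mode t d := by
  rintro ⟨A, hsig, hA, hM⟩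
  obtain ⟨v₁, v₂, hv⟩ := exists_pair_ne V
  obtain ⟨s, C, Q₁, D₁, Q₂, D₂, hs, hC, hQ₁, hQ₂, hD₁, hD₂, hc₁, hc₂, hcover, hG, hG₁, hG₂⟩ :=
    exists_groups hn3 ht hd hn
  have hs₁ := Finset.disjoint_right.1 hG₁ hs
  have hs₂ := Finset.disjoint_right.1 hG₂ hs
  rw [Finset.mem_union, not_or] at hs₁ hs₂
  obtain ⟨r₁, hr₁, h₁, a₁, ha₁, p₁, hp₁⟩ := exists_oneSided (G := Q₁ ∪ D₁) hA hM hs hs₂.1 hs₂.2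
    (fun i => by have := hcover i; simp only [Finset.mem_union] at this ⊢; tauto) hQ₂ hD₂ hc₂ v₁
  obtain ⟨r₂, hr₂, h₂, a₂, ha₂, p₂, hp₂⟩ := exists_oneSided (G := Q₂ ∪ D₂) hA hM hs hs₁.1 hs₁.2
    (fun i => by have := hcover i; simp only [Finset.mem_union] at this ⊢; tauto) hQ₁ hD₁ hc₁ v₂
  -- The `+ 1` keeps the delivery step itself inside each spliced segment.
  set r₀ := splice r₁ r₂ (Q₁ ∪ D₁) (Q₂ ∪ D₂) C (p₁.1 + 1) (p₂.1 + 1)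
  have hsafe : r₀.SafeBefore A mode (p₁.1 + 1 + (p₂.1 + 1)) :=
    safeBefore_splice hsig hr₁ hr₂ h₁ h₂ hG hG₁ hG₂
  have hdel : ∀ i p v, r₀.DeliversAt A i p v 0 s → p.1 < p₁.1 + 1 + (p₂.1 + 1) →
      (r₀.fairExtension A ∅ (p₁.1 + 1 + (p₂.1 + 1))).Delivers A i v 0 s := by
    rintro i p v ⟨⟨x, hx⟩, hd⟩ hp
    refine ⟨p, ⟨x, by rw [fairExtension_event_of_lt hp, hx]⟩, ?_⟩
    rw [output_congr (r' := r₀) fun k hk => fairExtension_event_of_lt (by omega), hd]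
  have hd₁ := hdel _ _ _ ((embeds_splice_left _).deliversAt ha₁ (Nat.lt_succ_self _) hp₁)
    (by dsimp only; omega)
  have hd₂ := hdel _ _ _ ((embeds_splice_right hG).deliversAt ha₂ (Nat.lt_succ_self _) hp₂)
    (by dsimp only; omega)
  refine hv ((hM _ (isRunOf_fairExtension hsafe hC (by simp))).no_duplicity a₁ a₂ s v₁ v₂ 0
    (Finset.disjoint_left.1 hG₁ ha₁) (Finset.disjoint_left.1 hG₂ ha₂) ?_ hd₁ hd₂)
  rintro rfl
  exact Finset.disjoint_left.1 hG ha₁ ha₂
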